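/- Let $d\ge 1$ be an integer and let $t$ be a real number with $t>1/2$. For every $a\in\mathbb{S}^{d-1}\cap[0,+\infty)^d$, where $\mathbb{S}^{d-1}$ is the Euclidean unit sphere of $\mathbb{R}^d$ centered at the origin, let $$b(a)=\frac12\sum_{i=1}^d a_i-t,\qquad H_a=\{x\in\mathbb{R}^d : a\cdot x=b(a)\},$$ so that $H_a$ is a hyperplane orthogonal to $a$ at distance $t$ from the center $(1/2,\dots,1/2)$ of the hypercube $[0,1]^d$. Let $V(a)$ be the $(d-1)$-dimensional volume of $H_a\cap[0,1]^d$. Then the function $V$ attains a (finite) maximum on $\mathbb{S}^{d-1}\cap[0,+\infty)^d$: there is a vector $a^*\in\mathbb{S}^{d-1}\cap[0,+\infty)^d$ such that $V(a)\le V(a^*)<\infty$ for every $a\in\mathbb{S}^{d-1}\cap[0,+\infty)^d$. -/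

import Mathlib

open scoped MeasureTheory

/-- The hypercube `[0,1]^d` in Euclidean space. -/
def unitCube (d : ℕ) : Set (EuclideanSpace ℝ (Fin d)) :=
  {x | ∀ i, x i ∈ Set.Icc (0 : ℝ) 1}

/-- The offset `b = (1/2) ∑ i, a i - t`. -/
noncomputable def sectionOffset {d : ℕ} (t : ℝ) (a : EuclideanSpace ℝ (Fin d)) : ℝ :=
  (1 / 2) * ∑ i, a i - t

/-- The hyperplane `H` of the points `x` such that `a ⬝ x = b`. -/
def sectionHyperplane {d : ℕ} (t : ℝ) (a : EuclideanSpace ℝ (Fin d)) :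
    Set (EuclideanSpace ℝ (Fin d)) :=
  {x | inner ℝ a x = sectionOffset t a}

/-- The `(d-1)`-dimensional volume of `H ∩ [0,1]^d`, as the Euclidean Hausdorff measure (the
Hausdorff measure normalized to agree with Lebesgue measure on Euclidean spaces). -/
noncomputable def sectionVolume {d : ℕ} (t : ℝ) (a : EuclideanSpace ℝ (Fin d)) : ENNReal :=
  (μHE[d - 1] : MeasureTheory.Measure (EuclideanSpace ℝ (Fin d)))
    (sectionHyperplane t a ∩ unitCube d)

/-- The part `𝕊^{d-1} ∩ [0,∞)^d` of the unit sphere in the closed nonnegative orthant. -/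
def nonnegUnitSphere (d : ℕ) : Set (EuclideanSpace ℝ (Fin d)) :=
  Metric.sphere 0 1 ∩ {a | ∀ i, 0 ≤ a i}

/-! An upper semicontinuous function on a nonempty compact set attains its maximum, so
semicontinuity of the section volume suffices. For `a` near `a₀`, orthogonal projection onto the
hyperplane of `a₀` shrinks distances within the section of `a` by a factor close to 1 at worst, and
moves its points little. The image thus lies in the `a₀`-section of a thin thickening of the cube,
whose measure tends to that of the cube's own section. -/

open MeasureTheory Filter Topology Module in
/-- A map expanding distances on `s` by a factor at least `K⁻¹` does not decrease the Euclidean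
Hausdorff measure of `s` by more than the factor `K ^ n`. -/
theorem euclideanHausdorffMeasure_le_mul_image {X Y : Type*}
    [EMetricSpace X] [MeasurableSpace X] [BorelSpace X]
    [EMetricSpace Y] [MeasurableSpace Y] [BorelSpace Y]
    {K : NNReal} {f : X → Y} {s : Set X} (hf : AntilipschitzWith K (s.domRestrict f)) (n : ℕ) :
    (μHE[n] : Measure X) s ≤ (K : ENNReal) ^ n * (μHE[n] : Measure Y) (f '' s) := by
  have key := hf.le_hausdorffMeasure_image (d := n) (Nat.cast_nonneg n) Set.univ
  rw [← (isometry_subtype_coe (s := s)).hausdorffMeasure_image (Or.inl (Nat.cast_nonneg n)),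
    Set.image_univ, Set.image_univ, Subtype.range_coe, Set.range_domRestrict,
    ENNReal.rpow_natCast] at key
  simp_rw [Measure.euclideanHausdorffMeasure_def, Measure.smul_apply, ENNReal.smul_def,
    smul_eq_mul]
  calc _ ≤ _ := mul_le_mul_right key _
    _ = _ := by ring

section Hyperplane

open MeasureTheory Filter Topology Module

variable {E : Type*} [NormedAddCommGroup E] [InnerProductSpace ℝ E]

/-- The hyperplane of the points `x` with `⟪a, x⟫ = b`. -/
def innerHyperplane (a : E) (b : ℝ) : Set E := {x | inner ℝ a x = b}

theorem isClosed_innerHyperplane (a : E) (b : ℝ) : IsClosed (innerHyperplane a b) :=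
  isClosed_eq (by fun_prop) continuous_const

/-- For a unit vector `a`, the orthogonal projection onto the hyperplane `⟪a, x⟫ = b`. -/
def hyperplaneProj (a : E) (b : ℝ) (x : E) : E := x + (b - inner ℝ a x) • a

theorem hyperplaneProj_mem {a : E} (ha : ‖a‖ = 1) (b : ℝ) (x : E) :
    hyperplaneProj a b x ∈ innerHyperplane a b := by
  simp [innerHyperplane, hyperplaneProj, inner_add_right, inner_smul_right, ha]

theorem dist_hyperplaneProj_le {a₀ a x : E} (ha₀ : ‖a₀‖ = 1) {b₀ b : ℝ}
    (hx : x ∈ innerHyperplane a b) :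
    dist (hyperplaneProj a₀ b₀ x) x ≤ |b₀ - b| + ‖a - a₀‖ * ‖x‖ := by
  have hx' : inner ℝ a x = b := hx
  have h : b₀ - inner ℝ a₀ x = (b₀ - b) + inner ℝ (a - a₀) x := by
    rw [inner_sub_left, hx']; ring
  rw [dist_eq_norm, hyperplaneProj, add_sub_cancel_left, norm_smul, ha₀, mul_one, h]
  exact (norm_add_le _ _).trans (add_le_add le_rfl (norm_inner_le_norm _ _))

/-- Differences of points of `s` are orthogonal to `a`, so their component along `a₀`, which the
projection kills, is at most `‖a - a₀‖` times their length. -/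
theorem antilipschitzWith_hyperplaneProj {a₀ a : E} (ha₀ : ‖a₀‖ = 1) (h : ‖a - a₀‖ < 1)
    (b₀ b : ℝ) {s : Set E} (hs : s ⊆ innerHyperplane a b) :
    AntilipschitzWith (1 - ‖a - a₀‖).toNNReal⁻¹ (s.domRestrict (hyperplaneProj a₀ b₀)) := by
  refine AntilipschitzWith.of_le_mul_dist fun x y => ?_
  have hx : inner ℝ a (x : E) = b := hs x.2
  have hy : inner ℝ a (y : E) = b := hs y.2
  have hz : inner ℝ a₀ (x - y : E) = - inner ℝ (a - a₀) (x - y : E) := by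
    simp only [inner_sub_left, inner_sub_right, hx, hy]; ring
  have hP : (x - y : E) = (hyperplaneProj a₀ b₀ x - hyperplaneProj a₀ b₀ y)
      + (inner ℝ a₀ (x - y : E)) • a₀ := by
    simp only [hyperplaneProj, inner_sub_right]
    module
  have hb : ‖(inner ℝ a₀ (x - y : E)) • a₀‖ ≤ ‖a - a₀‖ * ‖(x - y : E)‖ := by
    rw [norm_smul, ha₀, mul_one, hz, norm_neg]
    exact norm_inner_le_norm _ _
  have hn := (congrArg norm hP).le.trans (norm_add_le _ _)
  have hpos : 0 < 1 - ‖a - a₀‖ := sub_pos.2 h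
  rw [NNReal.coe_inv, Real.coe_toNNReal _ hpos.le, inv_mul_eq_div, le_div_iff₀ hpos,
    Subtype.dist_eq, dist_eq_norm, dist_eq_norm]
  simp only [Set.domRestrict_apply]
  linarith

variable [FiniteDimensional ℝ E] [MeasurableSpace E] [BorelSpace E]

/-- Translating `(ℝ ∙ a)ᗮ` by `b • a` reduces this to Lebesgue measure of a bounded set. -/
theorem euclideanHausdorffMeasure_innerHyperplane_inter_lt_top {a : E} (ha : ‖a‖ = 1) (b : ℝ)
    {s : Set E} (hs : Bornology.IsBounded s) :
    (μHE[finrank ℝ E - 1] : Measure E) (innerHyperplane a b ∩ s) < ⊤ := by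
  have hrank : finrank ℝ (ℝ ∙ a)ᗮ = finrank ℝ E - 1 := by
    have ha0 : a ≠ 0 := by rintro rfl; simp at ha
    have := (ℝ ∙ a).finrank_add_finrank_orthogonal
    rw [finrank_span_singleton ha0] at this
    omega
  let φ : (ℝ ∙ a)ᗮ → E := fun v => (v : E) + b • a
  have hφ : Isometry φ := Isometry.of_dist_eq fun v w => by simp [φ, Subtype.dist_eq]
  have hrange : innerHyperplane a b ∩ s ⊆ φ '' (φ ⁻¹' s) := by
    rintro x ⟨hx, hxs⟩
    have hx : inner ℝ a x = b := hx
    have hmem : x - b • a ∈ (ℝ ∙ a)ᗮ := by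
      rw [Submodule.mem_orthogonal_singleton_iff_inner_right]
      simp [inner_sub_right, inner_smul_right, hx, ha]
    exact ⟨⟨_, hmem⟩, by simpa [φ] using hxs, by simp [φ]⟩
  have hbdd : Bornology.IsBounded (φ ⁻¹' s) := hφ.antilipschitz.isBounded_preimage hs
  refine (measure_mono hrange).trans_lt ?_
  rw [hφ.euclideanHausdorffMeasure_image, ← hrank,
    InnerProductSpace.euclideanHausdorffMeasure_eq_volume]
  exact hbdd.measure_lt_top

/-- The area of the section of a compact set by a hyperplane is an upper semicontinuous function
of the hyperplane. -/
theorem upperSemicontinuousOn_innerHyperplane_inter {b : E → ℝ} (hb : Continuous b)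
    {s : Set E} (hs : IsCompact s) :
    UpperSemicontinuousOn
      (fun a => (μHE[finrank ℝ E - 1] : Measure E) (innerHyperplane a (b a) ∩ s))
      (Metric.sphere 0 1) := by
  intro a₀ ha₀
  rw [mem_sphere_zero_iff_norm] at ha₀
  obtain ⟨R, hR⟩ := hs.isBounded.exists_norm_le
  set n := finrank ℝ E - 1
  set ν : Measure E := (μHE[n] : Measure E).restrict (innerHyperplane a₀ (b a₀)) with hν
  have hν_apply (u : Set E) (hu : IsClosed u) :
      ν u = (μHE[n] : Measure E) (innerHyperplane a₀ (b a₀) ∩ u) := by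
    rw [hν, Measure.restrict_apply hu.measurableSet, Set.inter_comm]
  have hfin {u : Set E} (hu : IsClosed u) (hu' : Bornology.IsBounded u) : ν u ≠ ⊤ := by
    rw [hν_apply u hu]
    exact (euclideanHausdorffMeasure_innerHyperplane_inter_lt_top ha₀ _ hu').ne
  -- Continuity from above needs one thickening of finite measure; radius 1 serves.
  have hthick : Tendsto (fun r => ν (Metric.cthickening r s)) (𝓝 0) (𝓝 (ν s)) :=
    tendsto_measure_cthickening_of_isClosed
      ⟨1, one_pos, hfin Metric.isClosed_cthickening hs.isBounded.cthickening⟩ hs.isClosed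
  -- Bounds how far the projection moves a point of the section of `s` by the hyperplane of `a`.
  let δ : E → ℝ := fun a => |b a₀ - b a| + ‖a - a₀‖ * R
  have hδ : Tendsto δ (𝓝 a₀) (𝓝 0) := by
    have : Continuous δ := by fun_prop
    simpa [δ] using this.tendsto a₀
  let K : E → NNReal := fun a => (1 - ‖a - a₀‖).toNNReal⁻¹
  have hK : Tendsto K (𝓝 a₀) (𝓝 1) := by
    have h : Continuous fun a : E => (1 - ‖a - a₀‖).toNNReal := by fun_prop
    simpa [K] using (h.tendsto a₀).inv₀ (by simp)
  have hlim : Tendsto (fun a => (K a : ENNReal) ^ n * ν (Metric.cthickening (δ a) s)) (𝓝 a₀)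
      (𝓝 (ν s)) := by
    have h1 : Tendsto (fun a => (K a : ENNReal) ^ n) (𝓝 a₀) (𝓝 1) := by
      have := ENNReal.tendsto_coe.2 (hK.pow n)
      simpa using this
    simpa using ENNReal.Tendsto.mul h1 (Or.inl one_ne_zero) (hthick.comp hδ)
      (Or.inr ENNReal.one_ne_top)
  intro y hy
  replace hy : ν s < y := by rwa [hν_apply s hs.isClosed]
  refine eventually_nhdsWithin_of_eventually_nhds ?_
  have hnear : ∀ᶠ a in 𝓝 a₀, ‖a - a₀‖ < 1 := by
    filter_upwards [Metric.ball_mem_nhds a₀ one_pos] with a ha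
    rwa [← dist_eq_norm]
  filter_upwards [hlim.eventually_lt_const hy, hnear] with a hay ha
  refine lt_of_le_of_lt ?_ hay
  refine (euclideanHausdorffMeasure_le_mul_image
    (antilipschitzWith_hyperplaneProj ha₀ ha (b a₀) (b a) Set.inter_subset_left) n).trans ?_
  rw [hν_apply _ Metric.isClosed_cthickening]
  refine mul_le_mul_right (measure_mono ?_) _
  rintro _ ⟨x, ⟨hxa, hxs⟩, rfl⟩
  refine ⟨hyperplaneProj_mem ha₀ _ _, Metric.mem_cthickening_of_dist_le _ x _ _ hxs ?_⟩
  refine (dist_hyperplaneProj_le ha₀ hxa).trans ?_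
  exact add_le_add le_rfl (mul_le_mul_of_nonneg_left (hR x hxs) (norm_nonneg _))

end Hyperplane

theorem isCompact_unitCube (d : ℕ) : IsCompact (unitCube d) := by
  have h : IsCompact (Set.univ.pi fun _ : Fin d => Set.Icc (0 : ℝ) 1) :=
    isCompact_univ_pi fun _ => isCompact_Icc
  convert h.image (PiLp.continuous_toLp 2 fun _ : Fin d => ℝ) using 1
  ext x
  refine ⟨fun hx => ⟨WithLp.ofLp x, fun i _ => hx i, rfl⟩, ?_⟩
  rintro ⟨y, hy, rfl⟩ i
  exact hy i trivial

theorem isCompact_nonnegUnitSphere (d : ℕ) : IsCompact (nonnegUnitSphere d) := by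
  refine (isCompact_sphere _ _).inter_right ?_
  rw [Set.ofPred_forall]
  exact isClosed_iInter fun i => isClosed_le continuous_const (by fun_prop)

theorem nonnegUnitSphere_nonempty {d : ℕ} (hd : 1 ≤ d) : (nonnegUnitSphere d).Nonempty := by
  refine ⟨EuclideanSpace.single ⟨0, hd⟩ 1, by simp, fun i => ?_⟩
  rw [PiLp.single_apply]
  split_ifs <;> norm_num

theorem mainTheorem6 (d : ℕ) (hd : 1 ≤ d) (t : ℝ) (ht : 1 / 2 < t) :
    ∃ a ∈ nonnegUnitSphere d,
      sectionVolume t a < ⊤ ∧ IsMaxOn (sectionVolume t) (nonnegUnitSphere d) a := by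
  have hb : Continuous (sectionOffset t : EuclideanSpace ℝ (Fin d) → ℝ) := by
    unfold sectionOffset; fun_prop
  have husc : UpperSemicontinuousOn (sectionVolume t) (nonnegUnitSphere d) := by
    have h := upperSemicontinuousOn_innerHyperplane_inter hb (isCompact_unitCube d)
    rw [finrank_euclideanSpace_fin] at h
    exact h.mono Set.inter_subset_left
  obtain ⟨a, ha, hmax⟩ :=
    husc.exists_isMaxOn (nonnegUnitSphere_nonempty hd) (isCompact_nonnegUnitSphere d)
  have hfin := euclideanHausdorffMeasure_innerHyperplane_inter_lt_top
    (mem_sphere_zero_iff_norm.1 ha.1) (sectionOffset t a) (isCompact_unitCube d).isBounded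
  rw [finrank_euclideanSpace_fin] at hfin
  exact ⟨a, ha, hfin, hmax⟩
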